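/- Let $s, m, m' \ge 0$ be integers, and let $X=(X_1,\dots,X_m)$ and $Y=(Y_1,\dots,Y_{m'})$ be finite families of vectors in $\mathbb{Z}^s\subset\mathbb{R}^s$ (repetitions allowed). Suppose that there is a vector $\eta\in\mathbb{R}^s$ such that both families are $\eta$-coplanar, i.e. $\langle \eta,X_j\rangle=1$ for all $1\le j\le m$ and $\langle\eta,Y_j\rangle=1$ for all $1\le j\le m'$. For such a family $X$ let $\mathbf{C}_X=\{\sum_{j} c_jX_j : c_j\in\mathbb{R},\ c_j\ge 0\}$ be its cone and $\mathcal{J}_X=\{\sum_j n_jX_j: n_j\in\mathbb{Z},\ n_j\ge 0\}$ its semigroup. For $z\in\mathcal{J}_X$ let $\mathbf{m}_X(z)$ be the (finite) number of words $i_1i_2\cdots i_n$, $n\ge 0$, over the alphabet $\{1,\dots,m\}$ with $X_{i_1}+\cdots+X_{i_n}=z$, and for any $x\in\mathbf{C}_X$ put $$\mathbf{m}_X(x)=\min\{\mathbf{m}_X(z) : z\in\mathcal{J}_X,\ \|x-z\|=d(x,\mathcal{J}_X)\},$$ where $\|\cdot\|$ is the Euclidean norm and $d(x,\mathcal{J}_X)=\min\{\|x-z\|: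 z\in\mathcal{J}_X\}$. The directional growth function of $X$ is defined on the unit vectors $\theta\in\mathbf{C}_X$ by $$\gamma_X(\theta)=\lim_{k\to\infty}\frac{\log \mathbf{m}_X(k\theta)}{k}\qquad (k\in\mathbb{N}),$$ where the limit is known to exist. If $X$ and $Y$ define the same directional growth function, that is, $\mathbf{C}_X=\mathbf{C}_Y$ and $\gamma_X(\theta)=\gamma_Y(\theta)$ for every unit vector $\theta$ in this common cone, then $m=m'$ and $X$ is a permutation of $Y$: there is a bijection $\sigma:\{1,\dots,m\}\to\{1,\dots,m'\}$ with $X_j=Y_{\sigma(j)}$ for all $j$. -/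

import Mathlib

open Filter Topology

namespace VectorSemigroup

noncomputable section

/-- The inclusion of the lattice `ℤ^s` into the Euclidean space `ℝ^s`. -/
def toEuclid {s : ℕ} (z : Fin s → ℤ) : EuclideanSpace ℝ (Fin s) :=
  WithLp.toLp 2 (fun i => (z i : ℝ))

/-- The position `κ(w) = X_{i₁} + ⋯ + X_{iₙ}` reached by the word `w = i₁ ⋯ iₙ` over the alphabet
`{1, …, m}`; the empty word reaches `0`. -/
def walk {s m : ℕ} (X : Fin m → Fin s → ℤ) (w : List (Fin m)) : Fin s → ℤ :=
  (w.map X).sum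

/-- The semigroup `𝒥 = X₁ℕ + ⋯ + X_mℕ` (with `0 ∈ ℕ`). -/
def semigroup {s m : ℕ} (X : Fin m → Fin s → ℤ) : Set (Fin s → ℤ) :=
  {z | ∃ n : Fin m → ℕ, z = ∑ j, n j • X j}

/-- The convex cone `C_X = X₁ℝ⁺ + ⋯ + X_mℝ⁺`, where `ℝ⁺` is the set of non-negative reals. -/
def cone {s m : ℕ} (X : Fin m → Fin s → ℤ) : Set (EuclideanSpace ℝ (Fin s)) :=
  {x | ∃ c : Fin m → ℝ, (∀ j, 0 ≤ c j) ∧ x = ∑ j, c j • toEuclid (X j)}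

/-- The multiplicity of a lattice point `z`: the number of words `w` with `κ(w) = z`. This set of
words is finite as soon as all the `X_j` lie in a common open half-space, in particular when they
are coplanar in the sense of `IsCoplanar`. -/
def latticeMultiplicity {s m : ℕ} (X : Fin m → Fin s → ℤ) (z : Fin s → ℤ) : ℕ :=
  {w : List (Fin m) | walk X w = z}.ncard

/-- The multiplicity of an arbitrary point `x`: the minimum of the multiplicities of the points of
the semigroup that are nearest to `x` in the Euclidean distance. Nearest points exist, because
the semigroup is a non-empty set of lattice points. -/
def multiplicity {s m : ℕ} (X : Fin m → Fin s → ℤ) (x : EuclideanSpace ℝ (Fin s)) : ℕ :=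
  sInf {n | ∃ z ∈ semigroup X,
    dist x (toEuclid z) = Metric.infDist x (toEuclid '' semigroup X) ∧
    n = latticeMultiplicity X z}

/-- The directional growth function `γ_X(θ) = lim_{k → ∞} log m(kθ) / k`, of interest for unit
vectors `θ` of the cone. -/
def growth {s m : ℕ} (X : Fin m → Fin s → ℤ) (θ : EuclideanSpace ℝ (Fin s)) : ℝ :=
  limUnder atTop (fun k : ℕ => Real.log (multiplicity X ((k : ℝ) • θ)) / (k : ℝ))

/-- `X₁, …, X_m` are `η`-coplanar: `⟨η, X_j⟩ = 1` for all `j`. -/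
def IsCoplanar {s m : ℕ} (η : EuclideanSpace ℝ (Fin s)) (X : Fin m → Fin s → ℤ) : Prop :=
  ∀ j, inner ℝ η (toEuclid (X j)) = 1

/-- `X` and `Y` define the same directional growth function: `C_X = C_Y`, and `γ_X = γ_Y` on the
unit vectors of this common cone. -/
def SameGrowth {s m m' : ℕ} (X : Fin m → Fin s → ℤ) (Y : Fin m' → Fin s → ℤ) : Prop :=
  cone X = cone Y ∧ ∀ θ ∈ cone X, ‖θ‖ = 1 → growth X θ = growth Y θ

end

end VectorSemigroup

namespace VectorSemigroup

open scoped Nat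

variable {s m : ℕ}

/-! Write `L_X(μ) = ∑ exp ⟪μ, X_j⟫`. The growth function determines `L_X`, in the manner of Legendre
duality, and `L_X` determines the family.

By coplanarity all words reaching `z` have length `N = ⟪η, z⟫`, so expanding `L_X(μ)^N` over words
gives `m(z) exp ⟪μ, z⟫ ≤ L_X(μ)^N`. Hence `γ_X(θ) ≤ ⟪η, θ⟫ log L_X(μ) - ⟪μ, θ⟫` for every `μ`,
wherever the limit exists. For `θ = ∑ exp ⟪μ, X_j⟫ X_j` a single multinomial coefficient already
attains this bound, by Stirling's formula (`tendsto_log_multiplicity_div`).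

At such a `θ`, equality for `X` and the upper bound for `Y` at the same `μ` give `L_X(μ) ≤ L_Y(μ)`
(`laplace_le_of_sameGrowth`); by symmetry `L_X = L_Y`. Distinct exponential characters are linearly
independent, so the multiplicity of each vector agrees in the two families. -/

theorem toEuclid_apply (z : Fin s → ℤ) (i : Fin s) : toEuclid z i = (z i : ℝ) := rfl

theorem toEuclid_zero : toEuclid (0 : Fin s → ℤ) = 0 := by
  ext i; simp [toEuclid_apply]

theorem toEuclid_add (x y : Fin s → ℤ) : toEuclid (x + y) = toEuclid x + toEuclid y := by
  ext i; simp [toEuclid_apply]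

theorem toEuclid_sub (x y : Fin s → ℤ) : toEuclid (x - y) = toEuclid x - toEuclid y := by
  ext i; simp [toEuclid_apply]

theorem toEuclid_injective : Function.Injective (toEuclid (s := s)) := by
  intro x y h
  ext i
  have := congrArg (fun v => v i) h
  simpa [toEuclid_apply] using this

theorem toEuclid_sum_zsmul (X : Fin m → Fin s → ℤ) (c : Fin m → ℤ) :
    toEuclid (∑ j, c j • X j) = ∑ j, (c j : ℝ) • toEuclid (X j) := by
  ext i; simp [toEuclid_apply]

theorem toEuclid_sum_nsmul (X : Fin m → Fin s → ℤ) (c : Fin m → ℕ) :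
    toEuclid (∑ j, c j • X j) = ∑ j, (c j : ℝ) • toEuclid (X j) := by
  ext i; simp [toEuclid_apply]

/-! ### Semigroup points near a point of the cone. -/

theorem finite_norm_toEuclid_le (R : ℝ) : {z : Fin s → ℤ | ‖toEuclid z‖ ≤ R}.Finite := by
  refine (Set.finite_Icc (fun _ : Fin s => -⌈R⌉) (fun _ => ⌈R⌉)).subset fun z hz => ?_
  have h : ∀ i, |(z i : ℝ)| ≤ ⌈R⌉ := fun i =>
    ((PiLp.norm_apply_le (toEuclid z) i).trans hz).trans (Int.le_ceil R)
  refine ⟨fun i => ?_, fun i => ?_⟩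
  · have := (abs_le.1 (h i)).1
    exact_mod_cast this
  · have := (abs_le.1 (h i)).2
    exact_mod_cast this

theorem exists_nearest {S : Set (Fin s → ℤ)} (hS : S.Nonempty) (x : EuclideanSpace ℝ (Fin s)) :
    ∃ z ∈ S, dist x (toEuclid z) = Metric.infDist x (toEuclid '' S) := by
  obtain ⟨z₀, hz₀⟩ := hS
  have hfin : (S ∩ {z | dist x (toEuclid z) ≤ dist x (toEuclid z₀)}).Finite := by
    refine (finite_norm_toEuclid_le (‖x‖ + dist x (toEuclid z₀))).subset fun z hz => ?_
    have h1 : dist x (toEuclid z) ≤ dist x (toEuclid z₀) := hz.2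
    have h2 := norm_le_norm_add_norm_sub x (toEuclid z)
    rw [← dist_eq_norm] at h2
    exact h2.trans (by linarith)
  obtain ⟨z, hz, hmin⟩ := Set.exists_min_image _ (fun z => dist x (toEuclid z)) hfin
    ⟨z₀, hz₀, le_refl (dist x (toEuclid z₀))⟩
  refine ⟨z, hz.1, le_antisymm ?_ (Metric.infDist_le_dist_of_mem ⟨z, hz.1, rfl⟩)⟩
  rw [Metric.le_infDist (Set.image_nonempty.2 ⟨z, hz.1⟩)]
  rintro _ ⟨y, hy, rfl⟩
  by_cases h : dist x (toEuclid y) ≤ dist x (toEuclid z₀)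
  · exact hmin y ⟨hy, h⟩
  · exact (show dist x (toEuclid z) ≤ dist x (toEuclid z₀) from hz.2).trans (not_le.1 h).le

theorem zero_mem_semigroup (X : Fin m → Fin s → ℤ) : (0 : Fin s → ℤ) ∈ semigroup X :=
  ⟨0, by simp⟩

theorem exists_multiplicity_eq (X : Fin m → Fin s → ℤ) (x : EuclideanSpace ℝ (Fin s)) :
    ∃ z ∈ semigroup X, dist x (toEuclid z) = Metric.infDist x (toEuclid '' semigroup X) ∧
      multiplicity X x = latticeMultiplicity X z := by
  obtain ⟨z, hz, h⟩ := exists_nearest ⟨0, zero_mem_semigroup X⟩ x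
  exact Nat.sInf_mem (s := {n | ∃ z ∈ semigroup X,
    dist x (toEuclid z) = Metric.infDist x (toEuclid '' semigroup X) ∧
    n = latticeMultiplicity X z}) ⟨_, z, hz, h, rfl⟩

theorem infDist_semigroup_le (X : Fin m → Fin s → ℤ) (c : Fin m → ℝ) (hc : ∀ j, 0 ≤ c j) :
    Metric.infDist (∑ j, c j • toEuclid (X j)) (toEuclid '' semigroup X) ≤
      ∑ j, ‖toEuclid (X j)‖ := by
  refine (Metric.infDist_le_dist_of_mem (Set.mem_image_of_mem toEuclid
    (show ∑ j, ⌊c j⌋₊ • X j ∈ semigroup X from ⟨fun j => ⌊c j⌋₊, rfl⟩))).trans ?_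
  rw [toEuclid_sum_nsmul, dist_eq_norm, ← Finset.sum_sub_distrib]
  refine (norm_sum_le _ _).trans (Finset.sum_le_sum fun j _ => ?_)
  rw [← sub_smul, norm_smul]
  refine mul_le_of_le_one_left (norm_nonneg _) ?_
  rw [Real.norm_eq_abs, abs_le]
  have h1 := Nat.floor_le (hc j)
  have h2 := Nat.lt_floor_add_one (c j)
  constructor <;> linarith

/-- A lattice point of the semigroup close to `∑ a j • X j` has integer coordinates close to `a`. -/
theorem exists_int_coords_near (X : Fin m → Fin s → ℤ) (R : ℝ) :
    ∃ D : ℝ, ∀ z ∈ semigroup X, ∀ a : Fin m → ℝ,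
      dist (∑ j, a j • toEuclid (X j)) (toEuclid z) ≤ R →
      ∃ c : Fin m → ℤ, z = ∑ j, c j • X j ∧ ∀ j, |(c j : ℝ) - a j| ≤ D := by
  classical
  -- One representation is fixed for each representable `d`. Only finitely many `d` of bounded norm
  -- occur below, which makes the constant uniform in `z` and `a`.
  have hpre : ∀ d : Fin s → ℤ, ∃ g : Fin m → ℤ,
      (∃ g' : Fin m → ℤ, d = ∑ j, g' j • X j) → d = ∑ j, g j • X j := by
    intro d
    by_cases h : ∃ g' : Fin m → ℤ, d = ∑ j, g' j • X j
    · exact ⟨h.choose, fun _ => h.choose_spec⟩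
    · exact ⟨0, fun h' => absurd h' h⟩
  choose g hg using hpre
  have hfin := finite_norm_toEuclid_le (s := s) (R + ∑ j, ‖toEuclid (X j)‖)
  refine ⟨1 + ∑ d ∈ hfin.toFinset, ∑ j, |(g d j : ℝ)|, ?_⟩
  rintro z ⟨n, hn⟩ a hR
  set d : Fin s → ℤ := z - ∑ j, ⌊a j⌋ • X j with hd
  have hdg : d = ∑ j, g d j • X j := by
    refine hg d ⟨fun j => n j - ⌊a j⌋, ?_⟩
    rw [hd, hn, ← Finset.sum_sub_distrib]
    exact Finset.sum_congr rfl fun j _ => by rw [sub_smul, natCast_zsmul]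
  have hnorm : d ∈ hfin.toFinset := by
    rw [Set.Finite.mem_toFinset]
    have h1 : toEuclid d = (toEuclid z - ∑ j, a j • toEuclid (X j)) +
        ∑ j, (a j - ⌊a j⌋) • toEuclid (X j) := by
      rw [hd, toEuclid_sub, toEuclid_sum_zsmul]
      simp only [sub_smul, Finset.sum_sub_distrib]
      abel
    have h2 : ‖∑ j, (a j - ⌊a j⌋) • toEuclid (X j)‖ ≤ ∑ j, ‖toEuclid (X j)‖ := by
      refine (norm_sum_le _ _).trans (Finset.sum_le_sum fun j _ => ?_)
      rw [norm_smul]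
      refine mul_le_of_le_one_left (norm_nonneg _) ?_
      rw [Real.norm_eq_abs, abs_le]
      have h1 := Int.floor_le (a j)
      have h2 := Int.lt_floor_add_one (a j)
      constructor <;> linarith
    rw [dist_comm, dist_eq_norm] at hR
    show ‖toEuclid d‖ ≤ _
    rw [h1]
    exact (norm_add_le _ _).trans (add_le_add hR h2)
  refine ⟨fun j => ⌊a j⌋ + g d j, ?_, fun j => ?_⟩
  · simp only [add_smul, Finset.sum_add_distrib]
    rw [← hdg, hd]
    abel
  · have h1 := Int.floor_le (a j)
    have h2 := Int.lt_floor_add_one (a j)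
    have h3 : |(g d j : ℝ)| ≤ ∑ d ∈ hfin.toFinset, ∑ j, |(g d j : ℝ)| :=
      (Finset.single_le_sum (f := fun j => |(g d j : ℝ)|) (fun _ _ => abs_nonneg _)
        (Finset.mem_univ j)).trans
      (Finset.single_le_sum (f := fun d => ∑ j, |(g d j : ℝ)|)
        (fun _ _ => Finset.sum_nonneg fun _ _ => abs_nonneg _) hnorm)
    have h4 : ((⌊a j⌋ + g d j : ℤ) : ℝ) - a j = (⌊a j⌋ - a j) + g d j := by push_cast; ring
    rw [h4]
    refine (abs_add_le _ _).trans (add_le_add ?_ h3)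
    rw [abs_le]
    constructor <;> linarith

/-! ### Counting words with a given endpoint. -/

theorem walk_nil (X : Fin m → Fin s → ℤ) : walk X [] = 0 := rfl

theorem walk_cons (X : Fin m → Fin s → ℤ) (j : Fin m) (w : List (Fin m)) :
    walk X (j :: w) = X j + walk X w := by simp [walk]

theorem inner_walk {η : EuclideanSpace ℝ (Fin s)} {X : Fin m → Fin s → ℤ}
    (hX : IsCoplanar η X) (w : List (Fin m)) :
    inner ℝ η (toEuclid (walk X w)) = w.length := by
  induction w with
  | nil => simp [walk_nil, toEuclid_zero]
  | cons j w ih =>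
    rw [walk_cons, toEuclid_add, inner_add_right, hX j, ih, List.length_cons]
    push_cast; ring

theorem finite_walk_eq {η : EuclideanSpace ℝ (Fin s)} {X : Fin m → Fin s → ℤ}
    (hX : IsCoplanar η X) (z : Fin s → ℤ) : {w | walk X w = z}.Finite := by
  refine (List.finite_length_eq (Fin m) ⌊inner ℝ η (toEuclid z)⌋₊).subset fun w hw => ?_
  have h := inner_walk hX w
  rw [show walk X w = z from hw] at h
  simp [h]

/-- Splitting the words that reach `z` according to their first letter. -/
theorem latticeMultiplicity_eq_sum {η : EuclideanSpace ℝ (Fin s)} {X : Fin m → Fin s → ℤ}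
    (hX : IsCoplanar η X) {z : Fin s → ℤ} (hz : z ≠ 0) :
    latticeMultiplicity X z = ∑ j, latticeMultiplicity X (z - X j) := by
  have hfin : ∀ y, Finite {w | walk X w = y} := fun y => finite_walk_eq hX y
  let e : (Σ j, {w | walk X w = z - X j}) → {w | walk X w = z} := fun p =>
    ⟨p.1 :: p.2.1, by
      have : walk X p.2.1 = z - X p.1 := p.2.2
      show walk X _ = z
      rw [walk_cons, this]; abel⟩
  have he : Function.Bijective e := by
    constructor
    · rintro ⟨i, v, hv⟩ ⟨j, w, hw⟩ h
      have h' : i :: v = j :: w := congrArg Subtype.val h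
      obtain ⟨rfl, rfl⟩ := List.cons.inj h'
      rfl
    · rintro ⟨w, hw⟩
      have hw' : walk X w = z := hw
      cases w with
      | nil => exact absurd (hw'.symm.trans (walk_nil X)) hz
      | cons j w =>
        refine ⟨⟨j, w, ?_⟩, rfl⟩
        show walk X w = z - X j
        rw [← hw', walk_cons]; abel
  unfold latticeMultiplicity
  simp only [← Nat.card_coe_set_eq]
  rw [← Nat.card_eq_of_bijective e he, Nat.card_sigma]

theorem latticeMultiplicity_zero_pos {η : EuclideanSpace ℝ (Fin s)} {X : Fin m → Fin s → ℤ}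
    (hX : IsCoplanar η X) : 0 < latticeMultiplicity X 0 :=
  (Set.ncard_pos (finite_walk_eq hX 0)).2 ⟨[], walk_nil X⟩

theorem inner_sum_nsmul {η : EuclideanSpace ℝ (Fin s)} {X : Fin m → Fin s → ℤ}
    (hX : IsCoplanar η X) (c : Fin m → ℕ) :
    inner ℝ η (toEuclid (∑ j, c j • X j)) = ((∑ j, c j : ℕ) : ℝ) := by
  rw [toEuclid_sum_nsmul, inner_sum]
  simp [inner_smul_right, hX _]

/-- The multinomial coefficient of `c` is at most the multiplicity of `∑ c j • X j`. -/
theorem factorial_le_mul_latticeMultiplicity {η : EuclideanSpace ℝ (Fin s)}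
    {X : Fin m → Fin s → ℤ} (hX : IsCoplanar η X) (N : ℕ) (c : Fin m → ℕ) (hc : ∑ j, c j = N) :
    N ! ≤ (∏ j, (c j)!) * latticeMultiplicity X (∑ j, c j • X j) := by
  induction N generalizing c with
  | zero =>
    have h0 : ∀ j, c j = 0 := fun j => by simpa using (Finset.sum_eq_zero_iff.1 hc) j
    simp only [h0]
    simpa [Nat.one_le_iff_ne_zero, Nat.pos_iff_ne_zero] using latticeMultiplicity_zero_pos hX
  | succ N ih =>
    have hz : ∑ j, c j • X j ≠ 0 := by
      intro h
      have := inner_sum_nsmul hX c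
      rw [h, hc, toEuclid_zero, inner_zero_right] at this
      exact (Nat.cast_ne_zero.2 (Nat.succ_ne_zero N)) this.symm
    rw [latticeMultiplicity_eq_sum hX hz, Finset.mul_sum, Nat.factorial_succ, ← hc,
      Finset.sum_mul]
    refine Finset.sum_le_sum fun j _ => ?_
    rcases Nat.eq_zero_or_pos (c j) with h0 | hpos
    · simp [h0]
    -- One occurrence of the first letter `j` is removed, as in the Pascal recursion for multinomial
    -- coefficients.
    set d : Fin m → ℕ := Function.update c j (c j - 1) with hd
    have hdj : d j + 1 = c j := by simp [hd]; omega
    have hdi : ∀ i ∈ Finset.univ.erase j, d i = c i := fun i hi => by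
      simp [hd, Function.update_of_ne (Finset.ne_of_mem_erase hi)]
    have hsum : ∑ i, d i = N := by
      have h1 := Finset.add_sum_erase Finset.univ c (Finset.mem_univ j)
      have h2 := Finset.add_sum_erase Finset.univ d (Finset.mem_univ j)
      have h3 : ∑ i ∈ Finset.univ.erase j, d i = ∑ i ∈ Finset.univ.erase j, c i :=
        Finset.sum_congr rfl hdi
      omega
    have hprod : ∏ i, (c i)! = c j * ∏ i, (d i)! := by
      rw [← Finset.mul_prod_erase _ _ (Finset.mem_univ j),
        ← Finset.mul_prod_erase _ (fun i => (d i)!) (Finset.mem_univ j),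
        Finset.prod_congr rfl (fun i hi => by rw [hdi i hi] : ∀ i ∈ Finset.univ.erase j,
          (d i)! = (c i)!), ← mul_assoc, ← hdj, Nat.factorial_succ]
    have hvec : ∑ i, c i • X i - X j = ∑ i, d i • X i := by
      rw [← Finset.add_sum_erase _ _ (Finset.mem_univ j),
        ← Finset.add_sum_erase _ (fun i => d i • X i) (Finset.mem_univ j),
        Finset.sum_congr rfl (fun i hi => by rw [hdi i hi] : ∀ i ∈ Finset.univ.erase j,
          d i • X i = c i • X i), ← hdj, add_smul, one_smul]
      abel
    rw [hprod, hvec, mul_assoc]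
    exact Nat.mul_le_mul_left _ (ih d hsum)

/-- The Laplace transform of the family `X`. -/
noncomputable def laplace (X : Fin m → Fin s → ℤ) (μ : EuclideanSpace ℝ (Fin s)) : ℝ :=
  ∑ j, Real.exp (inner ℝ μ (toEuclid (X j)))

theorem laplace_pos [NeZero m] (X : Fin m → Fin s → ℤ) (μ : EuclideanSpace ℝ (Fin s)) :
    0 < laplace X μ := Finset.sum_pos (fun _ _ => Real.exp_pos _) Finset.univ_nonempty

/-- Expanding `L(μ)^N` gives one term `exp ⟪μ, κ(w)⟫` for each word `w` of length `N`; the words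
ending at `z` form part of this positive sum. The induction strips the first letter. -/
theorem latticeMultiplicity_mul_exp_le {η : EuclideanSpace ℝ (Fin s)} {X : Fin m → Fin s → ℤ}
    (hX : IsCoplanar η X) (μ : EuclideanSpace ℝ (Fin s)) (N : ℕ) (z : Fin s → ℤ)
    (hz : inner ℝ η (toEuclid z) = (N : ℝ)) :
    latticeMultiplicity X z * Real.exp (inner ℝ μ (toEuclid z)) ≤ laplace X μ ^ N := by
  induction N generalizing z with
  | zero =>
    have hsub : {w | walk X w = z} ⊆ {w | w = [] ∧ z = 0} := by
      intro w hw
      have hw' : walk X w = z := hw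
      have h := inner_walk hX w
      rw [hw', hz] at h
      have : w = [] := List.eq_nil_of_length_eq_zero (by exact_mod_cast h.symm)
      subst this
      exact ⟨rfl, hw'.symm.trans (walk_nil X)⟩
    by_cases h0 : z = 0
    · subst h0
      have : latticeMultiplicity X 0 ≤ 1 := by
        refine (Set.ncard_le_ncard hsub ((Set.finite_singleton []).subset fun w hw => hw.1)).trans ?_
        simp
      simpa [toEuclid_zero] using this
    · have : {w | walk X w = z} = ∅ := Set.eq_empty_of_forall_notMem fun w hw => h0 (hsub hw).2
      simp [latticeMultiplicity, this]
  | succ N ih =>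
    have h0 : z ≠ 0 := by
      rintro rfl
      rw [toEuclid_zero, inner_zero_right] at hz
      exact (Nat.cast_ne_zero.2 (Nat.succ_ne_zero N)) hz.symm
    rw [latticeMultiplicity_eq_sum hX h0, pow_succ', laplace, Nat.cast_sum, Finset.sum_mul,
      Finset.sum_mul]
    refine Finset.sum_le_sum fun j _ => ?_
    have h1 := ih (z - X j) (by
      rw [toEuclid_sub, inner_sub_right, hX j, hz]; push_cast; ring)
    have h2 : inner ℝ μ (toEuclid z) =
        inner ℝ μ (toEuclid (X j)) + inner ℝ μ (toEuclid (z - X j)) := by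
      rw [← inner_add_right, ← toEuclid_add]; congr 2; abel
    rw [h2, Real.exp_add, mul_left_comm]
    exact mul_le_mul_of_nonneg_left h1 (Real.exp_pos _).le

/-! ### Asymptotics of factorials and multinomial coefficients. -/

/-- Stirling's formula, in logarithmic form with a sublinear error. -/
theorem tendsto_log_factorial_sub_div :
    Tendsto (fun n : ℕ => (Real.log n ! - (n * Real.log n - n)) / n) atTop (𝓝 0) := by
  have h1 : Tendsto (fun n : ℕ => Real.log (Stirling.stirlingSeq n) / (n : ℝ)) atTop (𝓝 0) :=
    (Stirling.tendsto_stirlingSeq_sqrt_pi.log (by positivity)).div_atTop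
      tendsto_natCast_atTop_atTop
  have h2 : Tendsto (fun n : ℕ => Real.log n / (n : ℝ)) atTop (𝓝 0) :=
    (Real.isLittleO_log_id_atTop.tendsto_div_nhds_zero).comp tendsto_natCast_atTop_atTop
  have h3 : Tendsto (fun n : ℕ => Real.log 2 / (n : ℝ)) atTop (𝓝 0) :=
    tendsto_const_nhds.div_atTop tendsto_natCast_atTop_atTop
  have h := h1.add ((h3.add h2).const_mul (1 / 2))
  simp only [add_zero, mul_zero] at h
  refine h.congr' ?_
  filter_upwards [eventually_gt_atTop 0] with n hn
  have hn' : (n : ℝ) ≠ 0 := by positivity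
  rw [Stirling.log_stirlingSeq_formula, Real.log_mul two_ne_zero hn',
    Real.log_div hn' (Real.exp_pos 1).ne', Real.log_exp]
  field_simp
  ring

/-- The subtracted term `u k * log k` is not `O(k)`, but it is linear in `u`, so it cancels in a
multinomial coefficient. -/
theorem tendsto_log_factorial_of_tendsto_div {u : ℕ → ℕ} {a : ℝ} (ha : 0 < a)
    (hu : Tendsto (fun k => (u k : ℝ) / k) atTop (𝓝 a)) :
    Tendsto (fun k => (Real.log (u k)! - u k * Real.log k) / (k : ℝ)) atTop
      (𝓝 (a * Real.log a - a)) := by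
  have hpos : ∀ᶠ k in atTop, 0 < (u k : ℝ) / k := hu.eventually (lt_mem_nhds ha)
  have hinf : Tendsto u atTop atTop := by
    rw [← tendsto_natCast_atTop_iff (R := ℝ)]
    refine (hu.pos_mul_atTop ha tendsto_natCast_atTop_atTop).congr' ?_
    filter_upwards [eventually_gt_atTop 0] with k hk
    field_simp
  have h := ((tendsto_log_factorial_sub_div.comp hinf).mul hu).add
    ((hu.mul (hu.log ha.ne')).sub hu)
  rw [zero_mul, zero_add] at h
  refine h.congr' ?_
  filter_upwards [hpos, eventually_gt_atTop 0] with k hk hk0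
  have hk0' : (0 : ℝ) < k := by exact_mod_cast hk0
  have huk : (0 : ℝ) < u k := by
    have := mul_pos hk hk0'
    rwa [div_mul_cancel₀ _ hk0'.ne'] at this
  rw [Real.log_div huk.ne' hk0'.ne']
  simp only [Function.comp_apply]
  field_simp
  ring

/-- The entropy asymptotics of multinomial coefficients. -/
theorem tendsto_log_multinomial {m : ℕ} [NeZero m] {n : ℕ → Fin m → ℕ} {a : Fin m → ℝ}
    (ha : ∀ j, 0 < a j) (hn : ∀ j, Tendsto (fun k => (n k j : ℝ) / k) atTop (𝓝 (a j))) :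
    Tendsto (fun k => (Real.log (∑ j, n k j)! - ∑ j, Real.log (n k j)!) / (k : ℝ)) atTop
      (𝓝 ((∑ j, a j) * Real.log (∑ j, a j) - ∑ j, a j * Real.log (a j))) := by
  have hsum : Tendsto (fun k => ((∑ j, n k j : ℕ) : ℝ) / k) atTop (𝓝 (∑ j, a j)) := by
    simp only [Nat.cast_sum, Finset.sum_div]
    exact tendsto_finsetSum _ fun j _ => hn j
  have h := (tendsto_log_factorial_of_tendsto_div
    (Finset.sum_pos (fun j _ => ha j) Finset.univ_nonempty) hsum).sub
    (tendsto_finsetSum Finset.univ fun j _ =>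
      tendsto_log_factorial_of_tendsto_div (ha j) (hn j))
  have e : (∑ j, a j) * Real.log (∑ j, a j) - ∑ j, a j - ∑ j, (a j * Real.log (a j) - a j) =
      (∑ j, a j) * Real.log (∑ j, a j) - ∑ j, a j * Real.log (a j) := by
    rw [Finset.sum_sub_distrib]; ring
  rw [e] at h
  refine h.congr fun k => ?_
  rw [← Finset.sum_div, ← sub_div, Finset.sum_sub_distrib, ← Finset.sum_mul, Nat.cast_sum]
  ring

/-! ### Exponential parametrisation of positive combinations. -/

/-- Every positive combination of vectors `v j` has the form `∑ exp ⟪μ, v j⟫ • v j`. -/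
theorem exists_sum_exp_inner_smul_eq {E : Type*} [NormedAddCommGroup E] [InnerProductSpace ℝ E]
    {m : ℕ} (v : Fin m → E) {c : Fin m → ℝ} (hc : ∀ j, 0 < c j) :
    ∃ μ : E, ∑ j, Real.exp (inner ℝ μ (v j)) • v j = ∑ j, c j • v j := by
  let T : E →ₗ[ℝ] (Fin m → ℝ) := LinearMap.pi fun j => (innerSL ℝ (v j)).toLinearMap
  have hT : ∀ μ j, T μ j = inner ℝ μ (v j) := fun μ j => real_inner_comm _ _
  let G : (Fin m → ℝ) → ℝ := fun u => ∑ j, (Real.exp (u j) - c j * u j)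
  have hG : Continuous G := by fun_prop
  -- For `x ≥ 0` use the tangent line of `exp` at `log (2 * c j)`, of slope `2 * c j`; for `x < 0`
  -- use only `exp x > 0`.
  have hbound : ∀ j : Fin m, ∀ x : ℝ,
      c j * |x| - |2 * c j * (1 - Real.log (2 * c j))| ≤ Real.exp x - c j * x := by
    intro j x
    have hcj := hc j
    have h1 := Real.add_one_le_exp (x - Real.log (2 * c j))
    rw [Real.exp_sub, Real.exp_log (by positivity), le_div_iff₀ (by positivity)] at h1
    have h2 := Real.exp_pos x
    have h3 := neg_abs_le (2 * c j * (1 - Real.log (2 * c j)))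
    have h4 := abs_nonneg (2 * c j * (1 - Real.log (2 * c j)))
    rcases abs_cases x with ⟨h, _⟩ | ⟨h, _⟩ <;> rw [h] <;> nlinarith
  have hlim : Tendsto G (cocompact (Fin m → ℝ)) atTop := by
    rcases isEmpty_or_nonempty (Fin m) with hm | hm
    · simp [Filter.cocompact_eq_bot]
    obtain ⟨i, hi⟩ := Finite.exists_min c
    set K : ℝ := ∑ j, |2 * c j * (1 - Real.log (2 * c j))|
    have hlow : ∀ u : Fin m → ℝ, c i * ‖u‖ - K ≤ G u := by
      intro u
      obtain ⟨j, hj⟩ : ∃ j, ‖u‖ ≤ |u j| := by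
        by_contra! h
        exact lt_irrefl _ ((pi_norm_lt_iff ((abs_nonneg _).trans_lt (h i))).2 h)
      have h1 : c i * ‖u‖ ≤ ∑ j, c j * |u j| := by
        refine (mul_le_mul (hi j) hj (norm_nonneg _) (hc j).le).trans ?_
        exact Finset.single_le_sum (f := fun j => c j * |u j|)
          (fun j _ => mul_nonneg (hc j).le (abs_nonneg _)) (Finset.mem_univ j)
      have h2 : ∑ j, (c j * |u j| - |2 * c j * (1 - Real.log (2 * c j))|) ≤ G u :=
        Finset.sum_le_sum fun j _ => hbound j (u j)
      rw [Finset.sum_sub_distrib] at h2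
      linarith
    refine tendsto_atTop_mono hlow (tendsto_atTop_add_const_right _ _ ?_)
    exact tendsto_norm_cocompact_atTop.const_mul_atTop (hc i)
  -- `T` need not be injective, so `G ∘ T` need not be coercive on `E`; the minimum is taken over
  -- the closed subspace `range T`.
  have hcl : IsClosed (LinearMap.range T : Set (Fin m → ℝ)) :=
    Submodule.closed_of_finiteDimensional _
  obtain ⟨⟨_, μ, rfl⟩, hμ⟩ := Continuous.exists_forall_le
    (f := fun u : LinearMap.range T => G u) (by fun_prop)
    (hlim.comp hcl.isClosedEmbedding_subtypeVal.tendsto_cocompact)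
  refine ⟨μ, ?_⟩
  -- The gradient of `G ∘ T` at `μ`: the derivative of `G` along `T y` is `⟪y, y⟫`, which vanishes
  -- at the minimum.
  set y : E := ∑ j, Real.exp (inner ℝ μ (v j)) • v j - ∑ j, c j • v j with hy
  have hder : HasDerivAt (fun t : ℝ => G (T μ + t • T y))
      (∑ j, (Real.exp (T μ j + 0 * T y j) * (1 * T y j) - c j * (1 * T y j))) 0 := by
    refine HasDerivAt.fun_sum fun j _ => ?_
    have h1 : HasDerivAt (fun t : ℝ => T μ j + t * T y j) (1 * T y j) 0 :=
      ((hasDerivAt_id (0 : ℝ)).mul_const _).const_add _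
    exact h1.exp.sub (h1.const_mul _)
  have hmin : IsLocalMin (fun t : ℝ => G (T μ + t • T y)) 0 := by
    refine Filter.Eventually.of_forall fun t => ?_
    have := hμ ⟨T μ + t • T y, μ + t • y, by simp⟩
    simpa using this
  have h0 := hmin.hasDerivAt_eq_zero hder
  have hyy : inner ℝ y y = (0 : ℝ) := by
    rw [← h0]
    conv_lhs => rw [hy, ← hy]
    nth_rewrite 2 [hy]
    rw [inner_sub_right, inner_sum, inner_sum, ← Finset.sum_sub_distrib]
    refine Finset.sum_congr rfl fun j _ => ?_
    rw [inner_smul_right, inner_smul_right, hT, hT]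
    simp
  exact sub_eq_zero.1 (inner_self_eq_zero.1 hyy)

/-! ### Exponential growth of the multiplicity along a ray. -/

theorem latticeMultiplicity_pos {η : EuclideanSpace ℝ (Fin s)} {X : Fin m → Fin s → ℤ}
    (hX : IsCoplanar η X) {z : Fin s → ℤ} (hz : z ∈ semigroup X) :
    0 < latticeMultiplicity X z := by
  obtain ⟨n, rfl⟩ := hz
  exact Nat.pos_of_mul_pos_left
    ((Nat.factorial_pos _).trans_le (factorial_le_mul_latticeMultiplicity hX _ n rfl))

theorem exists_multiplicity_eq_of_dist_le (X : Fin m → Fin s → ℤ) {c : Fin m → ℝ}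
    (hc : ∀ j, 0 ≤ c j) (k : ℕ) :
    ∃ z ∈ semigroup X,
      multiplicity X ((k : ℝ) • ∑ j, c j • toEuclid (X j)) = latticeMultiplicity X z ∧
      dist ((k : ℝ) • ∑ j, c j • toEuclid (X j)) (toEuclid z) ≤ ∑ j, ‖toEuclid (X j)‖ := by
  obtain ⟨z, hz, hd, hm⟩ := exists_multiplicity_eq X ((k : ℝ) • ∑ j, c j • toEuclid (X j))
  refine ⟨z, hz, hm, hd.trans_le ?_⟩
  have := infDist_semigroup_le X (fun j => (k : ℝ) * c j)
    fun j => mul_nonneg (Nat.cast_nonneg k) (hc j)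
  simpa only [Finset.smul_sum, smul_smul] using this

theorem tendsto_div_of_abs_sub_le {u : ℕ → ℝ} {a C : ℝ} (h : ∀ k : ℕ, |u k - k * a| ≤ C) :
    Tendsto (fun k : ℕ => u k / k) atTop (𝓝 a) := by
  have h1 : Tendsto (fun k : ℕ => (u k - k * a) / (k : ℝ)) atTop (𝓝 0) := by
    refine squeeze_zero_norm (a := fun k : ℕ => C / (k : ℝ)) (fun k => ?_)
      (tendsto_const_nhds.div_atTop tendsto_natCast_atTop_atTop)
    rw [norm_div, Real.norm_eq_abs, Real.norm_of_nonneg (Nat.cast_nonneg k)]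
    exact div_le_div_of_nonneg_right (h k) (Nat.cast_nonneg k)
  have h2 := h1.add_const a
  rw [zero_add] at h2
  refine h2.congr' ?_
  filter_upwards [eventually_gt_atTop 0] with k hk
  have : (k : ℝ) ≠ 0 := by positivity
  field_simp
  ring

theorem tendsto_inner_div (μ θ : EuclideanSpace ℝ (Fin s)) {x : ℕ → EuclideanSpace ℝ (Fin s)}
    {C : ℝ} (hx : ∀ k : ℕ, dist ((k : ℝ) • θ) (x k) ≤ C) :
    Tendsto (fun k : ℕ => inner ℝ μ (x k) / (k : ℝ)) atTop (𝓝 (inner ℝ μ θ)) := by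
  refine tendsto_div_of_abs_sub_le (C := ‖μ‖ * C) fun k => ?_
  have : inner ℝ μ (x k) - k * inner ℝ μ θ = inner ℝ μ (x k - (k : ℝ) • θ) := by
    rw [inner_sub_right, inner_smul_right]
  rw [this]
  refine (abs_real_inner_le_norm _ _).trans (mul_le_mul_of_nonneg_left ?_ (norm_nonneg _))
  rw [← dist_eq_norm, dist_comm]
  exact hx k

/-- Chernoff-type upper bound for the exponential growth of the multiplicity. -/
theorem exists_tendsto_log_multiplicity_le [NeZero m] {η : EuclideanSpace ℝ (Fin s)}
    {X : Fin m → Fin s → ℤ} (hX : IsCoplanar η X) {c : Fin m → ℝ} (hc : ∀ j, 0 ≤ c j)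
    {θ : EuclideanSpace ℝ (Fin s)} (hθ : θ = ∑ j, c j • toEuclid (X j))
    (μ : EuclideanSpace ℝ (Fin s)) :
    ∃ u : ℕ → ℝ,
      Tendsto u atTop (𝓝 (inner ℝ η θ * Real.log (laplace X μ) - inner ℝ μ θ)) ∧
      ∀ k : ℕ, Real.log (multiplicity X ((k : ℝ) • θ)) / (k : ℝ) ≤ u k := by
  subst hθ
  choose z hz hmul hdist using exists_multiplicity_eq_of_dist_le X hc
  refine ⟨fun k => inner ℝ η (toEuclid (z k)) / (k : ℝ) * Real.log (laplace X μ) -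
    inner ℝ μ (toEuclid (z k)) / (k : ℝ),
    ((tendsto_inner_div η _ hdist).mul_const _).sub (tendsto_inner_div μ _ hdist), fun k => ?_⟩
  beta_reduce
  rw [hmul, div_mul_eq_mul_div, ← sub_div]
  refine div_le_div_of_nonneg_right ?_ (Nat.cast_nonneg k)
  have hpos : (0 : ℝ) < latticeMultiplicity X (z k) := by
    exact_mod_cast latticeMultiplicity_pos hX (hz k)
  obtain ⟨n, hn⟩ := hz k
  have hN : inner ℝ η (toEuclid (z k)) = ((∑ j, n j : ℕ) : ℝ) := by rw [hn, inner_sum_nsmul hX]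
  have h := Real.log_le_log (by positivity) (latticeMultiplicity_mul_exp_le hX μ _ _ hN)
  rw [Real.log_mul hpos.ne' (Real.exp_pos _).ne', Real.log_exp, Real.log_pow] at h
  rw [hN]
  linarith

/-- With weights `a j = exp ⟪μ, X j⟫`, the term `∑ a j * log (a j)` of the entropy is `⟪μ, θ⟫`, so
the multinomial lower bound meets the Chernoff bound at the same `μ`. -/
theorem tendsto_log_multiplicity_div [NeZero m] {η : EuclideanSpace ℝ (Fin s)}
    {X : Fin m → Fin s → ℤ} (hX : IsCoplanar η X) {μ θ : EuclideanSpace ℝ (Fin s)}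
    (hθ : θ = ∑ j, Real.exp (inner ℝ μ (toEuclid (X j))) • toEuclid (X j)) :
    Tendsto (fun k : ℕ => Real.log (multiplicity X ((k : ℝ) • θ)) / (k : ℝ)) atTop
      (𝓝 (laplace X μ * Real.log (laplace X μ) - inner ℝ μ θ)) := by
  set a : Fin m → ℝ := fun j => Real.exp (inner ℝ μ (toEuclid (X j))) with ha
  have hapos : ∀ j, 0 < a j := fun j => Real.exp_pos _
  have hηθ : inner ℝ η θ = laplace X μ := by
    rw [hθ, inner_sum]
    simp [inner_smul_right, hX _, laplace]
  have hμθ : inner ℝ μ θ = ∑ j, a j * Real.log (a j) := by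
    rw [hθ, inner_sum]
    simp [inner_smul_right, ha]
  obtain ⟨u, hu, hle⟩ := exists_tendsto_log_multiplicity_le hX (fun j => (hapos j).le) hθ μ
  rw [hηθ] at hu
  choose z hz hmul hdist using exists_multiplicity_eq_of_dist_le X (fun j => (hapos j).le)
  rw [← hθ] at hmul hdist
  obtain ⟨D, hD⟩ := exists_int_coords_near X (∑ j, ‖toEuclid (X j)‖)
  have hex : ∀ k : ℕ, ∃ c : Fin m → ℤ, z k = ∑ j, c j • X j ∧ ∀ j, |(c j : ℝ) - k * a j| ≤ D := by
    intro k
    refine hD (z k) (hz k) (fun j => k * a j) ?_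
    have := hdist k
    rw [hθ, Finset.smul_sum] at this
    simpa only [smul_smul] using this
  choose c hcz hcD using hex
  have hcdiv : ∀ j, Tendsto (fun k => (c k j : ℝ) / k) atTop (𝓝 (a j)) := fun j =>
    tendsto_div_of_abs_sub_le fun k => hcD k j
  -- The integer coordinates stay within `D` of `k * a j` with `a j > 0`, so they are eventually the
  -- letter counts of actual words.
  have hcpos : ∀ᶠ k in atTop, ∀ j, 0 ≤ c k j := by
    rw [eventually_all]
    intro j
    filter_upwards [(hcdiv j).eventually (lt_mem_nhds (hapos j)), eventually_gt_atTop 0]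
      with k hk hk0
    have hk0' : (0 : ℝ) < k := by exact_mod_cast hk0
    have := mul_pos hk hk0'
    rw [div_mul_cancel₀ _ hk0'.ne'] at this
    exact_mod_cast this.le
  have hndiv : ∀ j, Tendsto (fun k => ((c k j).toNat : ℝ) / k) atTop (𝓝 (a j)) := by
    intro j
    refine (hcdiv j).congr' ?_
    filter_upwards [hcpos] with k hk
    congr 1
    exact_mod_cast (Int.toNat_of_nonneg (hk j)).symm
  have hlow := tendsto_log_multinomial (n := fun k j => (c k j).toNat) hapos hndiv
  rw [← hμθ] at hlow
  refine tendsto_of_tendsto_of_tendsto_of_le_of_le' hlow hu ?_ (Eventually.of_forall hle)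
  filter_upwards [hcpos] with k hk
  refine div_le_div_of_nonneg_right ?_ (Nat.cast_nonneg k)
  have hzk : z k = ∑ j, (c k j).toNat • X j := by
    rw [hcz k]
    refine Finset.sum_congr rfl fun j _ => ?_
    rw [← natCast_zsmul, Int.toNat_of_nonneg (hk j)]
  have h := factorial_le_mul_latticeMultiplicity hX _ (fun j => (c k j).toNat) rfl
  rw [← hzk, ← hmul] at h
  have hmpos : (0 : ℝ) < multiplicity X ((k : ℝ) • θ) := by
    rw [hmul]; exact_mod_cast latticeMultiplicity_pos hX (hz k)
  have h' := Real.log_le_log (by positivity) (Nat.cast_le (α := ℝ).2 h)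
  rw [Nat.cast_mul, Nat.cast_prod, Real.log_mul (by positivity) hmpos.ne',
    Real.log_prod (fun j _ => by positivity)] at h'
  linarith

/-! ### Comparison of the two Laplace transforms. -/

/-- A strictly positive combination of generators of a cone is a strictly positive combination of
any other finite family of generators. -/
theorem exists_pos_coeff {m' : ℕ} {X : Fin m → Fin s → ℤ} {Y : Fin m' → Fin s → ℤ}
    (hXY : cone X = cone Y) {a : Fin m → ℝ} (ha : ∀ j, 0 < a j) :
    ∃ c : Fin m' → ℝ, (∀ j, 0 < c j) ∧
      ∑ j, a j • toEuclid (X j) = ∑ j, c j • toEuclid (Y j) := by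
  have hsum : ∑ i, toEuclid (Y i) ∈ cone X := by
    rw [hXY]
    exact ⟨1, fun _ => zero_le_one, by simp⟩
  obtain ⟨b, hb, hbY⟩ := hsum
  -- Splitting off `ε • ∑ Y i` while staying in the cone makes every `Y`-coefficient at least `ε`.
  obtain ⟨ε, hε, hεa⟩ : ∃ ε : ℝ, 0 < ε ∧ ∀ j, ε * b j ≤ a j := by
    have h : ∀ᶠ ε in 𝓝[>] (0 : ℝ), ∀ j, ε * b j ≤ a j := by
      rw [eventually_all]
      intro j
      have : Tendsto (fun ε : ℝ => ε * b j) (𝓝 0) (𝓝 (0 * b j)) :=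
        tendsto_id.mul_const _
      rw [zero_mul] at this
      filter_upwards [nhdsWithin_le_nhds (this.eventually (gt_mem_nhds (ha j)))] with ε h
      exact h.le
    obtain ⟨ε, h1, h2⟩ := (h.and self_mem_nhdsWithin).exists
    exact ⟨ε, h2, h1⟩
  have hmem : ∑ j, (a j - ε * b j) • toEuclid (X j) ∈ cone Y := by
    rw [← hXY]
    exact ⟨_, fun j => sub_nonneg.2 (hεa j), rfl⟩
  obtain ⟨d, hd, hdY⟩ := hmem
  refine ⟨fun j => d j + ε, fun j => add_pos_of_nonneg_of_pos (hd j) hε, ?_⟩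
  simp only [add_smul, Finset.sum_add_distrib]
  rw [← hdY, ← Finset.smul_sum, hbY]
  simp only [sub_smul, Finset.sum_sub_distrib, Finset.smul_sum, smul_smul]
  abel

theorem laplace_sub_smul {η : EuclideanSpace ℝ (Fin s)} {X : Fin m → Fin s → ℤ}
    (hX : IsCoplanar η X) (μ : EuclideanSpace ℝ (Fin s)) (t : ℝ) :
    laplace X (μ - t • η) = laplace X μ / Real.exp t := by
  simp only [laplace, Finset.sum_div]
  refine Finset.sum_congr rfl fun j _ => ?_
  rw [inner_sub_left, real_inner_smul_left, hX j, mul_one, Real.exp_sub]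

theorem laplace_le_of_sameGrowth {m' : ℕ} [NeZero m] [NeZero m'] {X : Fin m → Fin s → ℤ}
    {Y : Fin m' → Fin s → ℤ} {η : EuclideanSpace ℝ (Fin s)} (hX : IsCoplanar η X)
    (hY : IsCoplanar η Y) (hXY : SameGrowth X Y) (μ : EuclideanSpace ℝ (Fin s)) :
    laplace X μ ≤ laplace Y μ := by
  set p := ∑ j, Real.exp (inner ℝ μ (toEuclid (X j))) • toEuclid (X j) with hp
  have hp0 : 0 < ‖p‖ := by
    rw [norm_pos_iff]
    intro h0
    have : inner ℝ η p = laplace X μ := by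
      rw [hp, inner_sum]
      simp [inner_smul_right, hX _, laplace]
    rw [h0, inner_zero_right] at this
    exact (laplace_pos X μ).ne this
  -- Growth is compared only on unit vectors. Shifting `μ` along `η` rescales `p` to norm one, and
  -- divides both Laplace transforms by the same factor.
  set ν := μ - Real.log ‖p‖ • η with hν
  set θ := ∑ j, Real.exp (inner ℝ ν (toEuclid (X j))) • toEuclid (X j) with hθ
  have hθp : θ = ‖p‖⁻¹ • p := by
    rw [hθ, hp, Finset.smul_sum]
    refine Finset.sum_congr rfl fun j _ => ?_
    rw [smul_smul, hν, inner_sub_left, real_inner_smul_left, hX j, mul_one, Real.exp_sub,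
      Real.exp_log hp0, ← hp, div_eq_inv_mul]
  have hθ1 : ‖θ‖ = 1 := by
    rw [hθp, norm_smul, norm_inv, norm_norm, inv_mul_cancel₀ hp0.ne']
  have hηθ : inner ℝ η θ = laplace X ν := by
    rw [hθ, inner_sum]
    simp [inner_smul_right, hX _, laplace]
  have hgrowthX : growth X θ = laplace X ν * Real.log (laplace X ν) - inner ℝ ν θ :=
    (tendsto_log_multiplicity_div hX hθ).limUnder_eq
  -- As `growth` is a `limUnder`, convergence must also be known for `Y`: `θ` is a positive
  -- combination of the `Y j`, hence has exponential form for some `ξ`. The bound itself is then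
  -- applied at `ν`, not at `ξ`.
  obtain ⟨c, hc, hcY⟩ := exists_pos_coeff hXY.1
    (fun j => Real.exp_pos (inner ℝ ν (toEuclid (X j))))
  obtain ⟨ξ, hξ⟩ := exists_sum_exp_inner_smul_eq (fun j => toEuclid (Y j)) hc
  have hlimY := tendsto_log_multiplicity_div hY (hcY.trans hξ.symm)
  have hgrowthY : growth Y θ = _ := hlimY.limUnder_eq
  obtain ⟨u, hu, hle⟩ := exists_tendsto_log_multiplicity_le hY (fun j => (hc j).le) hcY ν
  have hbound := le_of_tendsto_of_tendsto' hlimY hu hle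
  rw [← hgrowthY, ← hXY.2 θ ⟨_, fun j => (Real.exp_pos _).le, hθ⟩ hθ1, hgrowthX, hηθ,
    sub_le_sub_iff_right] at hbound
  have h := le_of_mul_le_mul_left hbound (laplace_pos X ν)
  rw [Real.log_le_log_iff (laplace_pos X ν) (laplace_pos Y ν), hν, laplace_sub_smul hX,
    laplace_sub_smul hY] at h
  exact (div_le_div_iff_of_pos_right (Real.exp_pos _)).1 h

theorem eq_zero_of_cone_subset {m' : ℕ} {X : Fin m → Fin s → ℤ} {Y : Fin m' → Fin s → ℤ}
    {η : EuclideanSpace ℝ (Fin s)} (hY : IsCoplanar η Y) (hXY : cone X = cone Y) (hm : m = 0) :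
    m' = 0 := by
  subst hm
  by_contra h
  let j : Fin m' := ⟨0, Nat.pos_of_ne_zero h⟩
  have : toEuclid (Y j) ∈ cone X := by
    rw [hXY]
    exact ⟨Pi.single j 1, fun i => by by_cases hi : i = j <;> simp [hi],
      by simp [Pi.single_apply, ite_smul]⟩
  obtain ⟨c, _, hc⟩ := this
  have h1 := hY j
  rw [hc] at h1
  simp at h1

theorem laplace_eq_of_sameGrowth {m' : ℕ} {X : Fin m → Fin s → ℤ} {Y : Fin m' → Fin s → ℤ}
    {η : EuclideanSpace ℝ (Fin s)} (hX : IsCoplanar η X)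
    (hY : IsCoplanar η Y) (hXY : SameGrowth X Y) : laplace X = laplace Y := by
  have hYX : SameGrowth Y X := ⟨hXY.1.symm, fun θ hθ h1 => (hXY.2 θ (hXY.1 ▸ hθ) h1).symm⟩
  by_cases hm : m = 0
  · have hm' := eq_zero_of_cone_subset hY hXY.1 hm
    subst hm hm'
    ext μ
    simp [laplace]
  · have hm' : m' ≠ 0 := fun h => hm (eq_zero_of_cone_subset hX hYX.1 h)
    have : NeZero m := ⟨hm⟩
    have : NeZero m' := ⟨hm'⟩
    ext μ
    exact le_antisymm (laplace_le_of_sameGrowth hX hY hXY μ)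
      (laplace_le_of_sameGrowth hY hX hYX μ)

/-! ### Recovering the family from its Laplace transform. -/

/-- The exponential character `μ ↦ exp ⟪μ, z⟫`. -/
noncomputable def expChar (z : Fin s → ℤ) :
    Multiplicative (EuclideanSpace ℝ (Fin s)) →* ℝ where
  toFun μ := Real.exp (inner ℝ μ.toAdd (toEuclid z))
  map_one' := by simp
  map_mul' x y := by simp [inner_add_left, Real.exp_add]

theorem expChar_injective : Function.Injective (expChar (s := s)) := by
  intro x y h
  apply toEuclid_injective
  refine ext_inner_left ℝ fun v => ?_
  exact Real.exp_injective (DFunLike.congr_fun h (Multiplicative.ofAdd v))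

/-- A finite family of lattice vectors is determined, up to order, by its Laplace transform. -/
theorem card_fiber_eq_of_laplace_eq {m' : ℕ} {X : Fin m → Fin s → ℤ} {Y : Fin m' → Fin s → ℤ}
    (h : laplace X = laplace Y) (z : Fin s → ℤ) :
    (Finset.univ.filter fun j => X j = z).card = (Finset.univ.filter fun j => Y j = z).card := by
  classical
  -- Dedekind's independence of characters; the coefficient of `expChar z` in a Laplace transform is
  -- the number of indices with value `z`.
  have hli : LinearIndependent ℝ (fun z : Fin s → ℤ => (expChar z : _ → ℝ)) :=
    (linearIndependent_monoidHom (Multiplicative (EuclideanSpace ℝ (Fin s))) ℝ).comp _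
      expChar_injective
  have hsum : ∑ j, Finsupp.single (X j) (1 : ℝ) = ∑ j, Finsupp.single (Y j) (1 : ℝ) := by
    apply hli
    simp only [map_sum, Finsupp.linearCombination_single, one_smul]
    ext μ
    have := congrFun h μ.toAdd
    simpa [laplace, expChar, Finset.sum_apply] using this
  have := DFunLike.congr_fun hsum z
  simp only [Finsupp.finsetSum_apply, Finsupp.single_apply, Finset.sum_boole] at this
  exact_mod_cast this

end VectorSemigroup

theorem mainTheorem1 {s m m' : ℕ} (X : Fin m → Fin s → ℤ) (Y : Fin m' → Fin s → ℤ)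
    (η : EuclideanSpace ℝ (Fin s))
    (hX : VectorSemigroup.IsCoplanar η X) (hY : VectorSemigroup.IsCoplanar η Y)
    (hXY : VectorSemigroup.SameGrowth X Y) :
    m = m' ∧ ∃ σ : Fin m ≃ Fin m', ∀ j, X j = Y (σ j) := by
  have hfib := VectorSemigroup.card_fiber_eq_of_laplace_eq
    (VectorSemigroup.laplace_eq_of_sameGrowth hX hY hXY)
  -- Equinumerous fibres over each lattice vector are matched and glued into `σ`.
  have e : ∀ z, {j // X j = z} ≃ {j // Y j = z} := fun z =>
    Fintype.equivOfCardEq (by simpa [Fintype.card_subtype] using hfib z)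
  let σ : Fin m ≃ Fin m' := (Equiv.sigmaFiberEquiv X).symm.trans
    ((Equiv.sigmaCongrRight e).trans (Equiv.sigmaFiberEquiv Y))
  exact ⟨by simpa using Fintype.card_congr σ, σ, fun j => (e (X j) ⟨j, rfl⟩).2.symm⟩
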